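/- There is a universal constant $c>0$ such that the following holds for all integers $m,n\ge 0$. Let $M_1,\dots,M_m$ be real $n\times n$ matrices with zero diagonal such that $\langle M_i,M_i\rangle=1$ for every $i$ and $\langle M_i,M_j\rangle=0$ for all $i\ne j$, where $\langle A,B\rangle=\sum_{k,l}A_{kl}B_{kl}$. Let $x$ be a standard Gaussian vector in $\mathbb{R}^n$, and let $x\dot\otimes x$ be the $n\times n$ matrix whose $(k,l)$ entry is $x_kx_l$ if $k\neq l$ and $0$ if $k=l$. Then for every real $r\ge 98m$, $$\Pr\Bigl[\sum_{i=1}^m\langle x\dot\otimes x,M_i\rangle^2\ge r\Bigr]\le\exp\Bigl(-c\,\frac{r}{m+\sqrt r}\Bigr),$$ where the fraction is read as $0$ when $m=r=0$. -/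

import Mathlib

open MeasureTheory ProbabilityTheory

noncomputable section

/-- The inner product of two real `n × n` matrices viewed as `n²`-dimensional vectors. -/
def matInner {n : ℕ} (A B : Matrix (Fin n) (Fin n) ℝ) : ℝ :=
  ∑ i, ∑ j, A i j * B i j

/-- The tensor square of `x` with zeros on the diagonal: its `(i, j)` entry is `x i * x j` if
`i ≠ j`, and `0` if `i = j`. -/
def dotTensor {n : ℕ} (x : EuclideanSpace ℝ (Fin n)) : Matrix (Fin n) (Fin n) ℝ :=
  Matrix.of fun i j => if i = j then 0 else x i * x j

end

/-! Let F(x) in ℝ^m collect the pairings of the tensor square of x with the M_i. For fixed u, ⟨u, F⟩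
is a centred quadratic form in x whose coefficient matrix has norm ‖u‖, so diagonalising gives E
exp⟨u, F⟩ ≤ exp(3‖u‖²) for ‖u‖ ≤ 1/4 (`stdGaussian_exp_matInner_dotTensor`). Averaging over u
against a Gaussian weight of variance s truncated to that ball turns this into control of ‖F‖: where
‖F‖ ≥ √r, the average is at least exp(sr/2)/2 times the full Gaussian mass
(`exp_mul_integral_le_setIntegral_exp_inner`). Tonelli and s of order 1/(m + √r) give the tail up to
a constant prefactor. The Markov bound 8m/r absorbs that prefactor, at the price of halving the
exponent. -/

/-! ### Exponential moments of Gaussian quadratic forms. -/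

theorem sqrt_inv_one_sub_le_exp {a : ℝ} (ha : |a| ≤ 1 / 4) :
    √(1 / (1 - 2 * a)) ≤ Real.exp (a + 3 * a ^ 2) := by
  obtain ⟨h1, h2⟩ := abs_le.1 ha
  have hpos : 0 < 1 - 2 * a := by linarith
  apply Real.sqrt_le_iff.2 ⟨(Real.exp_pos _).le, ?_⟩
  rw [← Real.exp_nat_mul, ← Real.exp_log (one_div_pos.2 hpos), Real.exp_le_exp, one_div,
    Real.log_inv]
  have hy : |2 * a| < 1 := by rw [abs_mul]; norm_num; linarith
  have h := (abs_le.1 (Real.abs_log_sub_add_sum_range_le hy 2)).1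
  simp only [Finset.sum_range_succ, Finset.sum_range_zero] at h
  -- The Taylor remainder of log(1 - 2a) after two terms costs at most 4a²; with the quadratic term
  -- 2a² and the square root's factor 1/2 this makes 3a².
  have h3 : |2 * a| ^ (2 + 1) / (1 - |2 * a|) ≤ (2 * a) ^ 2 := by
    have h4 : |2 * a| ≤ 1 / 2 := by rw [abs_mul]; norm_num; linarith
    rw [div_le_iff₀ (by linarith), pow_succ, sq_abs]
    nlinarith [sq_nonneg (2 * a)]
  push_cast at h ⊢
  nlinarith

theorem gaussianReal_exp_mul_sq {a : ℝ} (ha : |a| ≤ 1 / 4) :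
    Integrable (fun x : ℝ => Real.exp (a * x ^ 2)) (gaussianReal 0 1) ∧
      ∫ x, Real.exp (a * x ^ 2) ∂(gaussianReal 0 1) ≤ Real.exp (a + 3 * a ^ 2) := by
  obtain ⟨h1, h2⟩ := abs_le.1 ha
  have hpos : 0 < 1 - 2 * a := by linarith
  have key : ∫ x, Real.exp (a * x ^ 2) ∂(gaussianReal 0 1) = √(1 / (1 - 2 * a)) := by
    rw [integral_gaussianReal_eq_integral_smul one_ne_zero]
    have : ∀ x : ℝ, gaussianPDFReal 0 1 x • Real.exp (a * x ^ 2) =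
        (√(2 * Real.pi))⁻¹ * Real.exp (-(1 / 2 - a) * x ^ 2) := by
      intro x
      simp only [gaussianPDFReal, smul_eq_mul, NNReal.coe_one, mul_one, sub_zero]
      rw [mul_assoc, ← Real.exp_add]
      ring_nf
    simp_rw [this]
    rw [integral_const_mul, integral_gaussian, inv_mul_eq_div,
      ← Real.sqrt_div (by have := Real.pi_pos; apply div_nonneg <;> linarith)]
    congr 1
    have := Real.pi_pos
    have : 1 / 2 - a ≠ 0 := by linarith
    field_simp
  refine ⟨?_, key ▸ sqrt_inv_one_sub_le_exp ha⟩
  -- A non-integrable function has integral 0 by convention, but the value just computed is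
  -- positive.
  by_contra hn
  rw [integral_undef hn] at key
  exact (Real.sqrt_pos.2 (one_div_pos.2 hpos)).ne key

theorem Matrix.IsHermitian.sum_sq_eigenvalues {n : ℕ} {A : Matrix (Fin n) (Fin n) ℝ}
    (hA : A.IsHermitian) : ∑ i, hA.eigenvalues i ^ 2 = matInner A A := by
  have h1 : (A * A).trace = matInner A A := by
    simp only [Matrix.trace, Matrix.diag_apply, Matrix.mul_apply, matInner]
    refine Finset.sum_congr rfl fun i _ => Finset.sum_congr rfl fun j _ => ?_
    congr 1
    exact hA.apply i j
  rw [← h1]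
  conv_rhs => rw [hA.spectral_theorem, ← map_mul, Unitary.conjStarAlgAut_apply,
    Matrix.trace_mul_cycle, Unitary.coe_star_mul_self, one_mul, Matrix.diagonal_mul_diagonal,
    Matrix.trace_diagonal]
  simp [sq]

theorem Matrix.IsHermitian.inner_sum_smul_eigenvectorBasis {n : ℕ}
    {A : Matrix (Fin n) (Fin n) ℝ} (hA : A.IsHermitian) (y : Fin n → ℝ) :
    inner ℝ (∑ i, y i • hA.eigenvectorBasis i)
      (Matrix.toEuclideanLin A (∑ i, y i • hA.eigenvectorBasis i)) =
      ∑ i, hA.eigenvalues i * y i ^ 2 := by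
  have h : ∀ i, Matrix.toEuclideanLin A (hA.eigenvectorBasis i) =
      hA.eigenvalues i • hA.eigenvectorBasis i := by
    intro i
    rw [Matrix.toLpLin_apply, hA.mulVec_eigenvectorBasis]
    rfl
  simp only [map_sum, map_smul, h, smul_smul]
  rw [hA.eigenvectorBasis.orthonormal.inner_sum]
  refine Finset.sum_congr rfl fun i _ => ?_
  simp
  ring

/-- In an eigenbasis the coordinates are again independent standard Gaussians, so the expectation
factors. Trace zero cancels the first-order terms, and the norm bound keeps every eigenvalue within
1/4. -/
theorem stdGaussian_exp_quadratic {n : ℕ} {A : Matrix (Fin n) (Fin n) ℝ}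
    (hA : A.IsHermitian) (htr : A.trace = 0) (hn : matInner A A ≤ 1 / 16) :
    Integrable (fun x => Real.exp (inner ℝ x (Matrix.toEuclideanLin A x)))
      (stdGaussian (EuclideanSpace ℝ (Fin n))) ∧
    ∫ x, Real.exp (inner ℝ x (Matrix.toEuclideanLin A x))
      ∂(stdGaussian (EuclideanSpace ℝ (Fin n))) ≤ Real.exp (3 * matInner A A) := by
  have hl : ∀ i, |hA.eigenvalues i| ≤ 1 / 4 := by
    intro i
    apply abs_le_of_sq_le_sq _ (by norm_num)
    calc hA.eigenvalues i ^ 2 ≤ ∑ i, hA.eigenvalues i ^ 2 :=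
          Finset.single_le_sum (fun i _ => sq_nonneg (hA.eigenvalues i)) (Finset.mem_univ i)
      _ ≤ _ := by rw [hA.sum_sq_eigenvalues]; linarith
  have hmeas : Measurable (fun y : Fin n → ℝ => ∑ i, y i • hA.eigenvectorBasis i) := by fun_prop
  have hcont : Continuous fun x : EuclideanSpace ℝ (Fin n) =>
      Real.exp (inner ℝ x (Matrix.toEuclideanLin A x)) := by
    have := (Matrix.toEuclideanLin A).continuous_of_finiteDimensional
    fun_prop
  have hprod : ∀ y : Fin n → ℝ, Real.exp (∑ i, hA.eigenvalues i * y i ^ 2) =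
      ∏ i, Real.exp (hA.eigenvalues i * y i ^ 2) := fun y => Real.exp_sum _ _
  rw [stdGaussian_eq_map_pi_orthonormalBasis hA.eigenvectorBasis]
  rw [integrable_map_measure hcont.aestronglyMeasurable hmeas.aemeasurable,
    integral_map hmeas.aemeasurable hcont.aestronglyMeasurable]
  simp only [Function.comp_def, hA.inner_sum_smul_eigenvectorBasis, hprod]
  refine ⟨Integrable.fintype_prod (f := fun i x => Real.exp (hA.eigenvalues i * x ^ 2))
    fun i => (gaussianReal_exp_mul_sq (hl i)).1, ?_⟩
  rw [integral_fintype_prod_eq_prod (f := fun i x => Real.exp (hA.eigenvalues i * x ^ 2))]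
  calc _ ≤ ∏ i, Real.exp (hA.eigenvalues i + 3 * hA.eigenvalues i ^ 2) :=
        Finset.prod_le_prod (fun i _ => integral_nonneg fun x => (Real.exp_pos _).le)
          fun i _ => (gaussianReal_exp_mul_sq (hl i)).2
    _ = _ := by
      rw [← Real.exp_sum, Finset.sum_add_distrib, ← Finset.mul_sum, hA.sum_sq_eigenvalues]
      have := hA.trace_eq_sum_eigenvalues
      simp only [RCLike.ofReal_real_eq_id, id_eq] at this
      rw [← this, htr, zero_add]

/-- Symmetrising M leaves the quadratic form unchanged and does not increase the norm; the zero
diagonal gives trace zero. -/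
theorem stdGaussian_exp_matInner_dotTensor {n : ℕ} {M : Matrix (Fin n) (Fin n) ℝ}
    (hd : ∀ k, M k k = 0) (hn : matInner M M ≤ 1 / 16) :
    Integrable (fun x => Real.exp (matInner (dotTensor x) M))
      (stdGaussian (EuclideanSpace ℝ (Fin n))) ∧
    ∫ x, Real.exp (matInner (dotTensor x) M)
      ∂(stdGaussian (EuclideanSpace ℝ (Fin n))) ≤ Real.exp (3 * matInner M M) := by
  set A : Matrix (Fin n) (Fin n) ℝ := Matrix.of fun i j => (M i j + M j i) / 2 with hAdef
  have hA : A.IsHermitian := by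
    ext i j
    simp [hAdef, add_comm]
  have htr : A.trace = 0 := by simp [Matrix.trace, hAdef, hd]
  have hle : matInner A A ≤ matInner M M := by
    have hswap : ∑ i, ∑ j, M j i * M j i = matInner M M := Finset.sum_comm
    have : matInner A A ≤ ∑ i, ∑ j, (M i j * M i j / 2 + M j i * M j i / 2) := by
      refine Finset.sum_le_sum fun i _ => Finset.sum_le_sum fun j _ => ?_
      simp only [hAdef, Matrix.of_apply]
      nlinarith [sq_nonneg (M i j - M j i)]
    simp only [Finset.sum_add_distrib, ← Finset.sum_div] at this
    rw [hswap] at this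
    unfold matInner at this ⊢
    linarith
  have hq : ∀ x : EuclideanSpace ℝ (Fin n),
      matInner (dotTensor x) M = inner ℝ x (Matrix.toEuclideanLin A x) := by
    intro x
    have h1 : matInner (dotTensor x) M = ∑ i, ∑ j, x i * x j * M i j := by
      refine Finset.sum_congr rfl fun i _ => Finset.sum_congr rfl fun j _ => ?_
      by_cases h : i = j
      · subst h; simp [dotTensor, hd]
      · simp [dotTensor, h]
    have h2 : matInner (dotTensor x) M = ∑ i, ∑ j, x i * x j * M j i := by
      rw [h1, Finset.sum_comm]
      exact Finset.sum_congr rfl fun i _ => Finset.sum_congr rfl fun j _ => by ring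
    have h3 : inner ℝ x (Matrix.toEuclideanLin A x) = ∑ i, ∑ j, x i * x j * A i j := by
      simp only [PiLp.inner_apply, Matrix.toLpLin_apply, Matrix.mulVec, dotProduct,
        RCLike.inner_apply, conj_trivial, Finset.sum_mul]
      exact Finset.sum_congr rfl fun i _ => Finset.sum_congr rfl fun j _ => by ring
    have h4 : ∑ i, ∑ j, x i * x j * A i j =
        ((∑ i, ∑ j, x i * x j * M i j) + ∑ i, ∑ j, x i * x j * M j i) / 2 := by
      rw [← Finset.sum_add_distrib, Finset.sum_div]
      refine Finset.sum_congr rfl fun i _ => ?_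
      rw [← Finset.sum_add_distrib, Finset.sum_div]
      refine Finset.sum_congr rfl fun j _ => ?_
      simp only [hAdef, Matrix.of_apply]
      ring
    rw [h3, h4, ← h1, ← h2]
    ring
  simp only [hq]
  have := stdGaussian_exp_quadratic hA htr (hle.trans hn)
  exact ⟨this.1, this.2.trans (Real.exp_le_exp.2 (by linarith))⟩

/-! ### Truncated Gaussian integrals on a Euclidean space. -/

section
variable {E : Type*} [NormedAddCommGroup E] [InnerProductSpace ℝ E] [FiniteDimensional ℝ E]
  [MeasurableSpace E] [BorelSpace E]

theorem integrable_exp_neg_mul_norm_sq {b : ℝ} (hb : 0 < b) :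
    Integrable fun v : E => Real.exp (-b * ‖v‖ ^ 2) := by
  by_contra hn
  have h := GaussianFourier.integral_rexp_neg_mul_sq_norm (V := E) hb
  rw [integral_undef hn] at h
  exact (Real.rpow_pos_of_pos (div_pos Real.pi_pos hb) _).ne h

/-- Outside the ball, half of the exponent already yields a factor exp(-2d), which beats the 2^(d/2)
growth of the mass when b is halved. Dimension 0 gives no such gain and is treated apart. -/
theorem half_integral_exp_neg_le_setIntegral_closedBall {b ρ : ℝ} (hb : 0 < b) (hρ : 0 ≤ ρ)
    (h : 4 * Module.finrank ℝ E ≤ b * ρ ^ 2) :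
    (∫ v : E, Real.exp (-b * ‖v‖ ^ 2)) / 2 ≤
      ∫ v in Metric.closedBall (0 : E) ρ, Real.exp (-b * ‖v‖ ^ 2) := by
  set d := Module.finrank ℝ E with hd
  set Z := ∫ v : E, Real.exp (-b * ‖v‖ ^ 2) with hZ
  have hZ0 : 0 ≤ Z := integral_nonneg fun v => (Real.exp_pos _).le
  have hint := integrable_exp_neg_mul_norm_sq (E := E) hb
  have hint' := integrable_exp_neg_mul_norm_sq (E := E) (half_pos hb)
  rcases Nat.eq_zero_or_pos d with h0 | h0
  · have : Subsingleton E := Module.finrank_zero_iff.1 h0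
    have hB : Metric.closedBall (0 : E) ρ = Set.univ := by
      ext v; simp [Subsingleton.elim v 0, hρ]
    rw [hB, setIntegral_univ]
    linarith
  have hsplit := integral_add_compl (Metric.isClosed_closedBall (x := (0 : E)) (ε := ρ)).measurableSet
    hint
  have hc : ∫ v in (Metric.closedBall (0 : E) ρ)ᶜ, Real.exp (-b * ‖v‖ ^ 2) ≤ Z / 2 := by
    have hscale : ∫ v : E, Real.exp (-(b / 2) * ‖v‖ ^ 2) = (2 : ℝ) ^ (d / 2 : ℝ) * Z := by
      rw [hZ, GaussianFourier.integral_rexp_neg_mul_sq_norm hb,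
        GaussianFourier.integral_rexp_neg_mul_sq_norm (half_pos hb),
        ← Real.mul_rpow (by norm_num) (by have := Real.pi_pos; positivity)]
      congr 1
      field_simp
    calc ∫ v in (Metric.closedBall (0 : E) ρ)ᶜ, Real.exp (-b * ‖v‖ ^ 2)
        ≤ ∫ v in (Metric.closedBall (0 : E) ρ)ᶜ,
            Real.exp (-(2 * d)) * Real.exp (-(b / 2) * ‖v‖ ^ 2) := by
          refine setIntegral_mono_on hint.integrableOn (hint'.const_mul _).integrableOn
            (Metric.isClosed_closedBall).measurableSet.compl fun v hv => ?_
          rw [← Real.exp_add, Real.exp_le_exp]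
          have hv' : ρ < ‖v‖ := by simpa using hv
          have : ρ ^ 2 ≤ ‖v‖ ^ 2 := by gcongr
          nlinarith
      _ ≤ ∫ v, Real.exp (-(2 * d)) * Real.exp (-(b / 2) * ‖v‖ ^ 2) :=
          setIntegral_le_integral (hint'.const_mul _)
            (Filter.Eventually.of_forall fun v => by positivity)
      _ = Real.exp (-(2 * d)) * (2 : ℝ) ^ (d / 2 : ℝ) * Z := by
          rw [integral_const_mul, hscale, mul_assoc]
      _ ≤ 1 / 2 * Z := by
          gcongr
          have h2 : (2 : ℝ) ≤ Real.exp 1 := by linarith [Real.add_one_le_exp (1 : ℝ)]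
          have hd1 : (1 : ℝ) ≤ d := by exact_mod_cast h0
          calc Real.exp (-(2 * d)) * (2 : ℝ) ^ (d / 2 : ℝ)
              ≤ Real.exp (-(2 * d)) * Real.exp 1 ^ (d / 2 : ℝ) := by gcongr
            _ = Real.exp (-(3 / 2 * d)) := by
              rw [← Real.exp_mul, ← Real.exp_add]; ring_nf
            _ ≤ Real.exp (-1) := by rw [Real.exp_le_exp]; linarith
            _ ≤ 1 / 2 := by
              rw [Real.exp_neg, inv_le_comm₀ (Real.exp_pos _) (by norm_num)]; linarith
      _ = Z / 2 := by ring
  linarith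

theorem setIntegral_closedBall_eq_zero_of_odd {f : E → ℝ} (hf : ∀ v, f (-v) = -f v) (ρ : ℝ) :
    ∫ v in Metric.closedBall (0 : E) ρ, f v = 0 := by
  have hm : MeasurableSet (Metric.closedBall (0 : E) ρ) := Metric.isClosed_closedBall.measurableSet
  rw [← integral_indicator hm]
  have h := integral_neg_eq_self (Set.indicator (Metric.closedBall (0 : E) ρ) f) volume
  have h2 : ∀ v, Set.indicator (Metric.closedBall (0 : E) ρ) f (-v) =
      -Set.indicator (Metric.closedBall (0 : E) ρ) f v := by
    intro v
    by_cases hv : v ∈ Metric.closedBall (0 : E) ρ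
    · rw [Set.indicator_of_mem hv, Set.indicator_of_mem (by simpa using hv), hf]
    · rw [Set.indicator_of_notMem hv, Set.indicator_of_notMem (by simpa using hv), neg_zero]
  simp only [h2, integral_neg] at h
  linarith

/-- The Laplace transform of a centred Gaussian truncated to a ball is nearly as large as that of
the Gaussian itself, as long as the tilt moves the mean by at most half of the radius. -/
theorem exp_mul_integral_le_setIntegral_exp_inner {s t R : ℝ} (hs : 0 < s) (ht : 0 < t)
    (hdim : 32 * Module.finrank ℝ E * s ≤ R ^ 2) (hR : 2 * (s * t) ≤ R) {v : E} (hv : t ≤ ‖v‖) :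
    Real.exp (s * t ^ 2 / 2) * ((∫ u : E, Real.exp (-(1 / (2 * s)) * ‖u‖ ^ 2)) / 2) ≤
      ∫ u in Metric.closedBall (0 : E) R,
        Real.exp (inner ℝ u v) * Real.exp (-(1 / (2 * s)) * ‖u‖ ^ 2) := by
  have hvpos : 0 < ‖v‖ := ht.trans_le hv
  have hRpos : 0 < R := lt_of_lt_of_le (by positivity) hR
  set b := 1 / (2 * s) with hb
  have hbpos : 0 < b := by positivity
  -- The exact tilt would shift the mean by s • v, which may leave the ball; a shift of length s * t
  -- stays within R / 2.
  set a : E := (s * t / ‖v‖) • v with ha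
  have hanorm : ‖a‖ = s * t := by
    rw [ha, norm_smul, Real.norm_of_nonneg (by positivity)]; field_simp
  have hav : inner ℝ a v = s * t * ‖v‖ := by
    rw [ha, real_inner_smul_left, real_inner_self_eq_norm_sq]; field_simp
  set z : E := v - s⁻¹ • a with hz
  set g : E → ℝ := fun u => Real.exp (inner ℝ u v) * Real.exp (-b * ‖u‖ ^ 2) with hg
  have hgc : Continuous g := by fun_prop
  have hm : ∀ ρ, MeasurableSet (Metric.closedBall (0 : E) ρ) :=
    fun ρ => Metric.isClosed_closedBall.measurableSet
  have hpt : ∀ w : E, Real.exp (s * t ^ 2 / 2) *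
      (Real.exp (-b * ‖w‖ ^ 2) + inner ℝ w z * Real.exp (-b * ‖w‖ ^ 2)) ≤ g (w + a) := by
    intro w
    have h1 : g (w + a) = Real.exp (s * t * ‖v‖ - s * t ^ 2 / 2) *
        (Real.exp (inner ℝ w z) * Real.exp (-b * ‖w‖ ^ 2)) := by
      simp only [hg]
      rw [← Real.exp_add, ← Real.exp_add, ← Real.exp_add]
      congr 1
      rw [inner_add_left, hav, @norm_add_sq_real, hanorm, hz, inner_sub_right,
        real_inner_smul_right w a s⁻¹, hb]
      field_simp
      ring
    rw [h1]
    -- The residual tilt z is linearised from below; its odd part integrates to zero over the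
    -- centred ball.
    have h2 := Real.add_one_le_exp (inner ℝ w z)
    have h3 : s * t ^ 2 / 2 ≤ s * t * ‖v‖ - s * t ^ 2 / 2 := by
      nlinarith [mul_le_mul_of_nonneg_left hv (by positivity : 0 ≤ s * t)]
    calc _ = Real.exp (s * t ^ 2 / 2) * ((inner ℝ w z + 1) * Real.exp (-b * ‖w‖ ^ 2)) := by ring
      _ ≤ Real.exp (s * t ^ 2 / 2) * (Real.exp (inner ℝ w z) * Real.exp (-b * ‖w‖ ^ 2)) := by
        gcongr
      _ ≤ _ := by gcongr
  have hcont1 : Continuous fun w : E => Real.exp (-b * ‖w‖ ^ 2) := by fun_prop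
  have hcont2 : Continuous fun w : E => inner ℝ w z * Real.exp (-b * ‖w‖ ^ 2) := by fun_prop
  have hion : ∀ {f : E → ℝ} (_ : Continuous f) (ρ : ℝ),
      IntegrableOn f (Metric.closedBall (0 : E) ρ) :=
    fun hf ρ => hf.continuousOn.integrableOn_compact (isCompact_closedBall _ _)
  have hhalf := half_integral_exp_neg_le_setIntegral_closedBall (E := E) hbpos
    (half_pos hRpos).le (by rw [hb]; field_simp; linarith)
  calc Real.exp (s * t ^ 2 / 2) * ((∫ u : E, Real.exp (-b * ‖u‖ ^ 2)) / 2)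
      ≤ Real.exp (s * t ^ 2 / 2) *
          ∫ w in Metric.closedBall (0 : E) (R / 2), Real.exp (-b * ‖w‖ ^ 2) := by gcongr
    _ = ∫ w in Metric.closedBall (0 : E) (R / 2), Real.exp (s * t ^ 2 / 2) *
          (Real.exp (-b * ‖w‖ ^ 2) + inner ℝ w z * Real.exp (-b * ‖w‖ ^ 2)) := by
        rw [integral_const_mul, integral_add (hion hcont1 _) (hion hcont2 _),
          setIntegral_closedBall_eq_zero_of_odd (f := fun w => inner ℝ w z * _) (by simp),
          add_zero]
    _ ≤ ∫ w in Metric.closedBall (0 : E) (R / 2), g (w + a) :=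
        setIntegral_mono_on (hion (by fun_prop) _) (hion (by fun_prop) _) (hm _)
          fun w _ => hpt w
    _ ≤ ∫ w in (fun w => w + a) ⁻¹' Metric.closedBall (0 : E) R, g (w + a) := by
        refine setIntegral_mono_set ?_ (Filter.Eventually.of_forall fun w => by positivity) ?_
        · have : (fun w => w + a) ⁻¹' Metric.closedBall (0 : E) R = Metric.closedBall (-a) R := by
            ext w; simp [dist_eq_norm]
          rw [this]
          exact (Continuous.continuousOn (by fun_prop)).integrableOn_compact
            (isCompact_closedBall _ _)
        · refine Filter.Eventually.of_forall fun w hw => ?_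
          have hw' : ‖w‖ ≤ R / 2 := mem_closedBall_zero_iff.1 hw
          have : ‖w + a‖ ≤ R := (norm_add_le _ _).trans (by rw [hanorm]; linarith)
          exact mem_closedBall_zero_iff.2 this
    _ = ∫ u in Metric.closedBall (0 : E) R, g u :=
        (measurePreserving_add_right volume a).setIntegral_preimage_emb
          (MeasurableEquiv.addRight a).measurableEmbedding g _
end

/-! ### Matrix inner product identities and second moments. -/

theorem matInner_eq_sum_prod {n : ℕ} (A B : Matrix (Fin n) (Fin n) ℝ) :
    matInner A B = ∑ p : Fin n × Fin n, A p.1 p.2 * B p.1 p.2 :=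
  (Fintype.sum_prod_type fun p : Fin n × Fin n => A p.1 p.2 * B p.1 p.2).symm

theorem matInner_smul_right {n : ℕ} (a : ℝ) (A B : Matrix (Fin n) (Fin n) ℝ) :
    matInner A (a • B) = a * matInner A B := by
  simp only [matInner_eq_sum_prod, Finset.mul_sum, Matrix.smul_apply, smul_eq_mul]
  exact Finset.sum_congr rfl fun p _ => by ring

theorem matInner_comm {n : ℕ} (A B : Matrix (Fin n) (Fin n) ℝ) : matInner A B = matInner B A := by
  simp only [matInner, mul_comm]

theorem matInner_sum_right {n m : ℕ} (A : Matrix (Fin n) (Fin n) ℝ)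
    (B : Fin m → Matrix (Fin n) (Fin n) ℝ) :
    matInner A (∑ i, B i) = ∑ i, matInner A (B i) := by
  simp only [matInner_eq_sum_prod, Matrix.sum_apply, Finset.mul_sum]
  exact Finset.sum_comm

theorem matInner_sum_smul_self {n m : ℕ} {M : Fin m → Matrix (Fin n) (Fin n) ℝ}
    (h1 : ∀ i, matInner (M i) (M i) = 1) (h0 : ∀ i j, i ≠ j → matInner (M i) (M j) = 0)
    (u : EuclideanSpace ℝ (Fin m)) :
    matInner (∑ i, u i • M i) (∑ i, u i • M i) = ‖u‖ ^ 2 := by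
  rw [matInner_sum_right, EuclideanSpace.real_norm_sq_eq]
  refine Finset.sum_congr rfl fun i _ => ?_
  rw [matInner_smul_right, matInner_comm, matInner_sum_right, Finset.sum_eq_single i]
  · rw [matInner_smul_right, h1]; ring
  · intro j _ hj
    rw [matInner_smul_right, h0 i j hj.symm, mul_zero]
  · simp

theorem measurable_matInner_dotTensor {n : ℕ} (M : Matrix (Fin n) (Fin n) ℝ) :
    Measurable fun x : EuclideanSpace ℝ (Fin n) => matInner (dotTensor x) M := by
  unfold matInner
  refine Finset.measurable_sum _ fun i _ => Finset.measurable_sum _ fun j _ => ?_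
  by_cases h : i = j
  · simp [dotTensor, h]
  · simp only [dotTensor, Matrix.of_apply, h, if_false]
    fun_prop

theorem sq_le_exp_add_exp_sub_two (z : ℝ) : z ^ 2 ≤ Real.exp z + Real.exp (-z) - 2 := by
  have h1 : |z / 2| ≤ |Real.sinh (z / 2)| := by
    rw [Real.abs_sinh]
    exact Real.self_le_sinh_iff.2 (abs_nonneg _)
  have h2 := sq_le_sq.2 h1
  have h3 := Real.cosh_two_mul (z / 2)
  rw [Real.cosh_sq, mul_div_cancel₀ z two_ne_zero, Real.cosh_eq] at h3
  linarith

theorem integral_sq_matInner_dotTensor_le {n : ℕ} {M : Matrix (Fin n) (Fin n) ℝ}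
    (hd : ∀ k, M k k = 0) (hn : matInner M M = 1) :
    Integrable (fun x => matInner (dotTensor x) M ^ 2) (stdGaussian (EuclideanSpace ℝ (Fin n))) ∧
    ∫ x, matInner (dotTensor x) M ^ 2 ∂(stdGaussian (EuclideanSpace ℝ (Fin n))) ≤ 8 := by
  have hmgf : ∀ a : ℝ, a ^ 2 = 1 / 16 →
      Integrable (fun x => Real.exp (a * matInner (dotTensor x) M))
        (stdGaussian (EuclideanSpace ℝ (Fin n))) ∧
      ∫ x, Real.exp (a * matInner (dotTensor x) M)
        ∂(stdGaussian (EuclideanSpace ℝ (Fin n))) ≤ Real.exp (3 / 16) := by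
    intro a ha
    have hM : matInner (a • M) (a • M) = 1 / 16 := by
      rw [matInner_smul_right, matInner_comm, matInner_smul_right, hn, ← ha]; ring
    have := stdGaussian_exp_matInner_dotTensor (M := a • M) (by simp [hd]) hM.le
    simp only [matInner_smul_right a (dotTensor _) M, hM] at this
    refine ⟨this.1, this.2.trans (Real.exp_le_exp.2 (by norm_num))⟩
  -- The extreme admissible tilts ±1/4 bound the second moment by 16 (2 exp(3/16) - 2) ≤ 8.
  obtain ⟨hp, hp'⟩ := hmgf (1 / 4) (by norm_num)
  obtain ⟨hq, hq'⟩ := hmgf (-(1 / 4)) (by norm_num)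
  have hle : ∀ x, matInner (dotTensor x) M ^ 2 ≤
      16 * (Real.exp (1 / 4 * matInner (dotTensor x) M) +
        Real.exp (-(1 / 4) * matInner (dotTensor x) M) - 2) := by
    intro x
    have := sq_le_exp_add_exp_sub_two (1 / 4 * matInner (dotTensor x) M)
    rw [← neg_mul] at this
    linarith
  have hdom := ((hp.add hq).sub (integrable_const (2 : ℝ))).const_mul 16
  have hi : Integrable (fun x => matInner (dotTensor x) M ^ 2)
      (stdGaussian (EuclideanSpace ℝ (Fin n))) := by
    refine hdom.mono' ((measurable_matInner_dotTensor M).pow_const 2).aestronglyMeasurable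
      (Filter.Eventually.of_forall fun x => ?_)
    rw [Real.norm_of_nonneg (sq_nonneg _)]
    exact hle x
  refine ⟨hi, (integral_mono hi hdom hle).trans ?_⟩
  rw [integral_const_mul, integral_sub' (hp.add hq) (integrable_const _), integral_add' hp hq,
    integral_const]
  simp only [probReal_univ, one_smul]
  have : Real.exp (3 / 16) ≤ 5 / 4 :=
    (Real.exp_bound_div_one_sub_of_interval (by norm_num) (by norm_num)).trans (by norm_num)
  linarith

theorem stdGaussian_real_le_markov {m n : ℕ} {M : Fin m → Matrix (Fin n) (Fin n) ℝ}
    (hd : ∀ i k, M i k k = 0) (h1 : ∀ i, matInner (M i) (M i) = 1) (r : ℝ) :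
    r * (stdGaussian (EuclideanSpace ℝ (Fin n))).real
        {x | r ≤ ∑ i, matInner (dotTensor x) (M i) ^ 2} ≤ 8 * m := by
  have h := fun i => integral_sq_matInner_dotTensor_le (hd i) (h1 i)
  refine (mul_meas_ge_le_integral_of_nonneg (Filter.Eventually.of_forall fun x =>
    Finset.sum_nonneg fun i _ => sq_nonneg _) (integrable_finsetSum _ fun i _ => (h i).1) r).trans ?_
  rw [integral_finsetSum _ fun i _ => (h i).1]
  refine (Finset.sum_le_sum fun i _ => (h i).2).trans ?_
  simp [mul_comm]

/-! ### The tail bound and removal of its prefactor. -/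

theorem stdGaussian_real_le_exp {m n : ℕ} {M : Fin m → Matrix (Fin n) (Fin n) ℝ}
    (hd : ∀ i k, M i k k = 0) (h1 : ∀ i, matInner (M i) (M i) = 1)
    (h0 : ∀ i j, i ≠ j → matInner (M i) (M j) = 0) {r : ℝ} (hr : 0 < r) :
    (stdGaussian (EuclideanSpace ℝ (Fin n))).real
        {x | r ≤ ∑ i, matInner (dotTensor x) (M i) ^ 2} ≤
      2 * Real.exp (3 / 16) * Real.exp (-(r / (1024 * (m + √r)))) := by
  have ht : 0 < √r := Real.sqrt_pos.2 hr
  have hmt : 0 < (m : ℝ) + √r := by positivity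
  -- With radius 1/4, the truncation lemma needs s ≤ 1/(512m) and s ≤ 1/(8√r).
  set s : ℝ := 1 / (512 * (m + √r)) with hs
  have hspos : 0 < s := by positivity
  set b : ℝ := 1 / (2 * s) with hb
  have hbpos : 0 < b := by positivity
  set E := EuclideanSpace ℝ (Fin m)
  set F : EuclideanSpace ℝ (Fin n) → E :=
    fun x => WithLp.toLp 2 fun i => matInner (dotTensor x) (M i) with hF
  set μ := stdGaussian (EuclideanSpace ℝ (Fin n))
  set B := Metric.closedBall (0 : E) (1 / 4) with hB
  have hBm : MeasurableSet B := Metric.isClosed_closedBall.measurableSet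
  set Z := ∫ u : E, Real.exp (-b * ‖u‖ ^ 2) with hZ
  have hint := integrable_exp_neg_mul_norm_sq (E := E) hbpos
  have hZpos : 0 < Z := by
    rw [hZ, GaussianFourier.integral_rexp_neg_mul_sq_norm hbpos]
    exact Real.rpow_pos_of_pos (div_pos Real.pi_pos hbpos) _
  set A := {x : EuclideanSpace ℝ (Fin n) | r ≤ ∑ i, matInner (dotTensor x) (M i) ^ 2} with hA
  have hFm : Measurable F := by
    refine (WithLp.measurable_toLp 2 _).comp (measurable_pi_lambda _ fun i => ?_)
    exact measurable_matInner_dotTensor (M i)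
  have hAm : MeasurableSet A :=
    measurableSet_le measurable_const
      (Finset.measurable_sum _ fun i _ => (measurable_matInner_dotTensor (M i)).pow_const 2)
  have hinner : ∀ x u, inner ℝ u (F x) = matInner (dotTensor x) (∑ i, u i • M i) := by
    intro x u
    rw [matInner_sum_right]
    simp only [matInner_smul_right, hF]
    exact Finset.sum_congr rfl fun i _ => mul_comm _ _
  have hup : ∀ u ∈ B, ∫⁻ x, ENNReal.ofReal (Real.exp (inner ℝ u (F x))) ∂μ ≤
      ENNReal.ofReal (Real.exp (3 / 16)) := by
    intro u hu
    have hu' : ‖u‖ ^ 2 ≤ 1 / 16 := by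
      have : ‖u‖ ≤ 1 / 4 := mem_closedBall_zero_iff.1 hu
      nlinarith [norm_nonneg u]
    have hM := matInner_sum_smul_self h1 h0 u
    obtain ⟨hi, hle⟩ := stdGaussian_exp_matInner_dotTensor (M := ∑ i, u i • M i)
      (fun k => by simp [Matrix.sum_apply, hd]) (hM.trans_le hu')
    simp only [hinner]
    rw [← ofReal_integral_eq_lintegral_ofReal hi
      (Filter.Eventually.of_forall fun x => (Real.exp_pos _).le)]
    refine ENNReal.ofReal_le_ofReal (hle.trans (Real.exp_le_exp.2 ?_))
    rw [hM]; linarith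
  have hlow : ∀ x ∈ A, ENNReal.ofReal (Real.exp (s * √r ^ 2 / 2) * (Z / 2)) ≤
      ∫⁻ u in B, ENNReal.ofReal (Real.exp (inner ℝ u (F x)) * Real.exp (-b * ‖u‖ ^ 2)) := by
    intro x hx
    have hnorm : √r ≤ ‖F x‖ := by
      apply Real.sqrt_le_iff.2 ⟨norm_nonneg _, ?_⟩
      rw [EuclideanSpace.real_norm_sq_eq]
      exact hx
    have hdim : 32 * Module.finrank ℝ E * s ≤ (1 / 4 : ℝ) ^ 2 := by
      rw [finrank_euclideanSpace_fin, hs, mul_one_div, div_le_iff₀ (by positivity)]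
      linarith
    have hR : 2 * (s * √r) ≤ 1 / 4 := by
      rw [hs, one_div_mul_eq_div, ← mul_div_assoc, div_le_iff₀ (by positivity)]
      have : (0 : ℝ) ≤ m := Nat.cast_nonneg m
      linarith
    rw [← ofReal_integral_eq_lintegral_ofReal
      ((Continuous.continuousOn (by fun_prop)).integrableOn_compact (isCompact_closedBall _ _))
      (Filter.Eventually.of_forall fun u => by positivity)]
    exact ENNReal.ofReal_le_ofReal
      (exp_mul_integral_le_setIntegral_exp_inner hspos ht hdim hR hnorm)
  have hmeas : Measurable fun p : EuclideanSpace ℝ (Fin n) × E =>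
      ENNReal.ofReal (Real.exp (inner ℝ p.2 (F p.1)) * Real.exp (-b * ‖p.2‖ ^ 2)) := by
    have : Measurable fun p : EuclideanSpace ℝ (Fin n) × E => F p.1 := hFm.comp measurable_fst
    fun_prop
  have hchain : ENNReal.ofReal (Real.exp (s * √r ^ 2 / 2) * (Z / 2)) * μ A ≤
      ENNReal.ofReal (Real.exp (3 / 16) * Z) := by
    calc _ = ∫⁻ x in A, ENNReal.ofReal (Real.exp (s * √r ^ 2 / 2) * (Z / 2)) ∂μ := by
          rw [setLIntegral_const]
      _ ≤ ∫⁻ x in A, (∫⁻ u in B,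
            ENNReal.ofReal (Real.exp (inner ℝ u (F x)) * Real.exp (-b * ‖u‖ ^ 2))) ∂μ :=
          setLIntegral_mono' hAm hlow
      _ ≤ ∫⁻ x, (∫⁻ u in B,
            ENNReal.ofReal (Real.exp (inner ℝ u (F x)) * Real.exp (-b * ‖u‖ ^ 2))) ∂μ :=
          setLIntegral_le_lintegral _ _
      _ = ∫⁻ u in B, ∫⁻ x,
            ENNReal.ofReal (Real.exp (inner ℝ u (F x)) * Real.exp (-b * ‖u‖ ^ 2)) ∂μ :=
          lintegral_lintegral_swap hmeas.aemeasurable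
      _ ≤ ∫⁻ u in B, ENNReal.ofReal (Real.exp (3 / 16)) *
            ENNReal.ofReal (Real.exp (-b * ‖u‖ ^ 2)) := by
          refine setLIntegral_mono' hBm fun u hu => ?_
          simp only [ENNReal.ofReal_mul (Real.exp_pos _).le]
          rw [lintegral_mul_const' _ _ ENNReal.ofReal_ne_top]
          gcongr
          exact hup u hu
      _ ≤ ∫⁻ u : E, ENNReal.ofReal (Real.exp (3 / 16)) *
            ENNReal.ofReal (Real.exp (-b * ‖u‖ ^ 2)) := setLIntegral_le_lintegral _ _
      _ = _ := by
          rw [lintegral_const_mul' _ _ ENNReal.ofReal_ne_top,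
            ← ofReal_integral_eq_lintegral_ofReal hint
              (Filter.Eventually.of_forall fun u => (Real.exp_pos _).le),
            ENNReal.ofReal_mul (Real.exp_pos _).le]
  have hreal := ENNReal.toReal_mono ENNReal.ofReal_ne_top hchain
  rw [ENNReal.toReal_mul, ENNReal.toReal_ofReal (by positivity),
    ENNReal.toReal_ofReal (by positivity)] at hreal
  change _ * μ.real A ≤ _ at hreal
  have hexp : s * √r ^ 2 / 2 = r / (1024 * (m + √r)) := by
    rw [Real.sq_sqrt hr.le, hs]; field_simp; norm_num
  rw [hexp] at hreal
  rw [Real.exp_neg, ← div_eq_mul_inv, le_div_iff₀ (Real.exp_pos _)]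
  refine le_of_mul_le_mul_right ?_ (half_pos hZpos)
  linarith

theorem theorem3p3 :
    ∃ c : ℝ, 0 < c ∧
      ∀ (m n : ℕ) (M : Fin m → Matrix (Fin n) (Fin n) ℝ),
        (∀ i k, M i k k = 0) →
        (∀ i, matInner (M i) (M i) = 1) →
        (∀ i j, i ≠ j → matInner (M i) (M j) = 0) →
        ∀ r : ℝ, 98 * (m : ℝ) ≤ r →
          (stdGaussian (EuclideanSpace ℝ (Fin n))).real
              {x | r ≤ ∑ i, matInner (dotTensor x) (M i) ^ 2}
            ≤ Real.exp (-(c * (r / ((m : ℝ) + √r)))) := by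
  refine ⟨1 / 2048, by norm_num, fun m n M hd h1 h0 r hr => ?_⟩
  have hm : (0 : ℝ) ≤ m := Nat.cast_nonneg m
  rcases (show 0 ≤ r by linarith).eq_or_lt with rfl | hpos
  -- At r = 0 the exponent vanishes, so the bound is 1.
  · simp
  have hmarkov := stdGaussian_real_le_markov hd h1 r
  have htail := stdGaussian_real_le_exp hd h1 h0 hpos
  set P := (stdGaussian (EuclideanSpace ℝ (Fin n))).real
    {x | r ≤ ∑ i, matInner (dotTensor x) (M i) ^ 2} with hP
  have hP0 : 0 ≤ P := measureReal_nonneg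
  have hP1 : P ≤ 1 / 12 := by
    refine le_of_mul_le_mul_left ?_ hpos
    linarith
  have he : Real.exp (3 / 16) ≤ 3 :=
    (Real.exp_le_exp.2 (by norm_num)).trans Real.exp_one_lt_three.le
  -- One factor of P² is bounded by 1/12, the other by the tail with prefactor at most 6; the square
  -- root turns 1/1024 into 1/2048.
  refine le_of_sq_le_sq ?_ (Real.exp_pos _).le
  have hsq : Real.exp (-(1 / 2048 * (r / (m + √r)))) ^ 2 =
      Real.exp (-(r / (1024 * (m + √r)))) := by
    rw [← Real.exp_nat_mul]
    congr 1
    have : 0 < (m : ℝ) + √r := by positivity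
    field_simp
    norm_num
  rw [hsq]
  have hX := Real.exp_pos (-(r / (1024 * (m + √r))))
  calc P ^ 2 = P * P := sq P
    _ ≤ 1 / 12 * (2 * Real.exp (3 / 16) * Real.exp (-(r / (1024 * (m + √r))))) := by gcongr
    _ ≤ _ := by nlinarith
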